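/- Let $-\infty<a<b<\infty$. For $\alpha>0$ and a continuous $g$ on $[a,b]$ put $J_a^\alpha g(t)=\frac1{\Gamma(\alpha)}\int_a^t(t-s)^{\alpha-1}g(s)\,ds$, and $J_a^0g=g$. For $\alpha>0$ and $m=\lceil\alpha\rceil$, a function $x\in C^{m-1}[a,b]$ is called continuously Caputo $\alpha$-differentiable if ${}^{C}\!D_a^\alpha x:=D^mJ_a^{m-\alpha}(x-T_{m-1}[x;a])$ exists and is continuous on $[a,b]$, where $T_{m-1}[x;a](t)=\sum_{i=0}^{m-1}\frac{(D^ix)(a)}{i!}(t-a)^i$; put ${}^{C}\!D_a^0x=x$ (continuously Caputo $0$-differentiable means continuous). Let $k\ge1$ and let $0=\alpha_0<\alpha_1<\dots<\alpha_k$ be rational numbers with $\alpha_j-\alpha_{j-1}\le1$ for $j=1,\dots,k$. Let $M$ be the least common multiple of the denominators of $\alpha_1,\dots,\alpha_k$, $\gamma=1/M$ and $N=M\alpha_k$. Let $f:[a,b]\times\mathbb{R}^k\to\mathbb{R}$ be continuous, and assume that there is $L>0$ with $|f(t,y)-f(t,z)|\le L\|y-z\|$ for all $t\in[a,b]$ and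 $y,z\in\mathbb{R}^k$. Let $x_a^{(0)},\dots,x_a^{(\lceil\alpha_k\rceil-1)}$ be real numbers. Consider (A) the multi-term problem $${}^{C}\!D_a^{\alpha_k}x(t)=f\bigl(t,x(t),{}^{C}\!D_a^{\alpha_1}x(t),\dots,{}^{C}\!D_a^{\alpha_{k-1}}x(t)\bigr)\quad(t\in[a,b]),\qquad (D^jx)(a)=x_a^{(j)}\quad(0\le j\le\lceil\alpha_k\rceil-1),$$ whose solutions are the continuously Caputo $\alpha_k$-differentiable functions $x$ on $[a,b]$ that satisfy it, and (B) the single-term system of order $\gamma$ on $[a,b]$ $${}^{C}\!D_a^{\gamma}x_j(t)=x_{j+1}(t)\quad(0\le j\le N-2),\qquad {}^{C}\!D_a^{\gamma}x_{N-1}(t)=f\bigl(t,x_0(t),x_{\alpha_1/\gamma}(t),\dots,x_{\alpha_{k-1}/\gamma}(t)\bigr),$$ with $x_j(a)=x_a^{(j/M)}$ if $j/M$ is an integer and $x_j(a)=0$ otherwise $(0\le j\le N-1)$, whose solutions are the vector functions $(x_0,\dots,x_{N-1})$ with continuously Caputo $\gamma$-differentiable components that satisfy it. Then (A) has a unique solution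 on $[a,b]$, and (B) has a unique solution on $[a,b]$. Moreover, if $(x_0,\dots,x_{N-1})$ solves (B), then $x_0$ solves (A); and if $x$ solves (A), then $x$ is continuously Caputo $j\gamma$-differentiable for $0\le j\le N$, and $(x,{}^{C}\!D_a^{\gamma}x,{}^{C}\!D_a^{2\gamma}x,\dots,{}^{C}\!D_a^{(N-1)\gamma}x)$ solves (B). -/

import Mathlib

open Set

noncomputable section

namespace Caputo

/-- The Riemann-Liouville fractional integral `J_a^α f`, with `J_a^0 = I`. -/
def rlIntegral (a α : ℝ) (f : ℝ → ℝ) (x : ℝ) : ℝ :=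
  if α = 0 then f x
  else 1 / Real.Gamma α * ∫ t in a..x, (x - t) ^ (α - 1) * f t

/-- The Riemann-Liouville derivative `D^m J_a^{m-α} f` on `[a,b]`, `m = ⌈α⌉` (identity for `α = 0`).
Integer-order derivatives are taken relative to `[a,b]`, hence one-sided at the endpoints. -/
def rlDeriv (a b α : ℝ) (f : ℝ → ℝ) (t : ℝ) : ℝ :=
  if α = 0 then f t
  else iteratedDerivWithin ⌈α⌉₊ (rlIntegral a (⌈α⌉₊ - α) f) (Icc a b) t

/-- For `α > 0`: `f` is continuous on `[a,b]`, and `D^m J_a^{m-α} f`, `m = ⌈α⌉`, exists and is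
continuous on `[a,b]`. -/
def ContRLDiff (a b α : ℝ) (f : ℝ → ℝ) : Prop :=
  ContinuousOn f (Icc a b) ∧
    (α ≠ 0 → ContDiffOn ℝ ⌈α⌉₊ (rlIntegral a (⌈α⌉₊ - α) f) (Icc a b))

/-- `f - T_{m-1}[f;a]`, where `m = ⌈α⌉` and `T_{m-1}[f;a]` is the Taylor polynomial of degree
`m - 1` of `f` at `a`; used for `α > 0` only, so that `m ≥ 1`. -/
def subTaylor (a b α : ℝ) (f : ℝ → ℝ) (t : ℝ) : ℝ :=
  f t - taylorWithinEval f (⌈α⌉₊ - 1) (Icc a b) a t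

/-- The Caputo derivative of order `α` on `[a,b]` (identity for `α = 0`). -/
def caputoDeriv (a b α : ℝ) (f : ℝ → ℝ) (t : ℝ) : ℝ :=
  if α = 0 then f t else rlDeriv a b α (subTaylor a b α f) t

/-- `f` is continuously Caputo `α`-differentiable on `[a,b]`: `f ∈ C^{⌈α⌉-1}[a,b]` and its Caputo
derivative of order `α` exists and is continuous on `[a,b]` (for `α = 0`: `f` is continuous). -/
def ContCaputoDiff (a b α : ℝ) (f : ℝ → ℝ) : Prop :=
  if α = 0 then ContinuousOn f (Icc a b)
  else ContDiffOn ℝ (⌈α⌉₊ - 1 : ℕ) f (Icc a b) ∧ ContRLDiff a b α (subTaylor a b α f)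

variable {k : ℕ}

/-- `x` solves `D^{α_k} x(t) = f(t, x(t), D^{α_1} x(t), …, D^{α_{k-1}} x(t))` on `[a,b]`,
`(D^j x)(a) = ξ j` for `j = 0, …, ⌈α_k⌉ - 1`. Here `α 0` stands for `0`, so that the zeroth
state argument of `f` is `x(t)`. -/
structure IsMultiTermSolution (a b : ℝ) (α : Fin (k + 1) → ℚ) (f : ℝ → (Fin k → ℝ) → ℝ)
    (ξ : ℕ → ℝ) (x : ℝ → ℝ) : Prop where
  contDiff : ContCaputoDiff a b (α (Fin.last k)) x
  equation : ∀ t ∈ Icc a b, caputoDeriv a b (α (Fin.last k)) x t =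
    f t (fun i => caputoDeriv a b (α i.castSucc) x t)
  initial : ∀ j < ⌈α (Fin.last k)⌉₊, iteratedDerivWithin j x (Icc a b) a = ξ j

/-- The least common multiple `M` of the denominators of the orders. -/
def lcmDen (α : Fin (k + 1) → ℚ) : ℕ := Finset.univ.lcm fun i => (α i).den

/-- The natural number `M α_i = α_i / γ`. -/
def scaled (α : Fin (k + 1) → ℚ) (i : Fin (k + 1)) : ℕ := ⌊(lcmDen α : ℚ) * α i⌋₊

/-- The dimension `N = M α_k`. -/
def dim (α : Fin (k + 1) → ℚ) : ℕ := scaled α (Fin.last k)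

theorem lcmDen_pos (α : Fin (k + 1) → ℚ) : 0 < lcmDen α := by
  refine Nat.pos_of_ne_zero fun h => ?_
  obtain ⟨i, _, hi⟩ := Finset.lcm_eq_zero_iff.1 h
  exact (α i).den_nz hi

theorem scaled_cast (α : Fin (k + 1) → ℚ) (i : Fin (k + 1)) (hi : 0 ≤ α i) :
    (scaled α i : ℚ) = lcmDen α * α i := by
  obtain ⟨c, hc⟩ : (α i).den ∣ lcmDen α := Finset.dvd_lcm (Finset.mem_univ i)
  have h : (lcmDen α : ℚ) * α i = ((c * (α i).num.toNat : ℕ) : ℚ) := by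
    have hn : (((α i).num.toNat : ℕ) : ℚ) = (α i).num := by
      exact_mod_cast congrArg (Int.cast : ℤ → ℚ) (Int.toNat_of_nonneg (Rat.num_nonneg.2 hi))
    rw [hc]
    push_cast
    rw [hn, mul_comm ((α i).den : ℚ) c, mul_assoc, Rat.den_mul_eq_num]
  rw [scaled, h, Nat.floor_natCast]

theorem scaled_lt (α : Fin (k + 1) → ℚ) (h0 : α 0 = 0) (hα : StrictMono α) (i : Fin k) :
    scaled α i.castSucc < dim α := by
  have hnn : ∀ j, 0 ≤ α j := fun j => h0 ▸ hα.monotone (Fin.zero_le j)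
  have hM : (0 : ℚ) < lcmDen α := by exact_mod_cast lcmDen_pos α
  have h : (scaled α i.castSucc : ℚ) < (dim α : ℚ) := by
    rw [dim, scaled_cast α _ (hnn _), scaled_cast α _ (hnn _)]
    exact mul_lt_mul_of_pos_left (hα (Fin.castSucc_lt_last i)) hM
  exact_mod_cast h

theorem dim_pos (α : Fin (k + 1) → ℚ) (h0 : α 0 = 0) (hα : StrictMono α) (hk : 0 < k) :
    0 < dim α :=
  (Nat.zero_le _).trans_lt (scaled_lt α h0 hα ⟨0, hk⟩)

/-- The index `α_i / γ` of a component of the reduced system. -/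
def termIndex (α : Fin (k + 1) → ℚ) (h0 : α 0 = 0) (hα : StrictMono α) (i : Fin k) :
    Fin (dim α) :=
  ⟨scaled α i.castSucc, scaled_lt α h0 hα i⟩

/-- `X = (x_0, …, x_{N-1})` solves on `[a,b]` the single-term system of order `γ = 1/M`
`D^γ x_j = x_{j+1}` for `j < N - 1`, `D^γ x_{N-1} = f(t, x_0, x_{α_1/γ}, …, x_{α_{k-1}/γ})`,
with `x_j(a) = ξ (j/M)` if `M ∣ j` and `x_j(a) = 0` otherwise. -/
structure IsReducedSolution (a b : ℝ) (α : Fin (k + 1) → ℚ) (h0 : α 0 = 0) (hα : StrictMono α)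
    (f : ℝ → (Fin k → ℝ) → ℝ) (ξ : ℕ → ℝ) (X : Fin (dim α) → ℝ → ℝ) : Prop where
  contDiff : ∀ j, ContCaputoDiff a b (1 / lcmDen α) (X j)
  chain : ∀ i j : Fin (dim α), (i : ℕ) + 1 = j → ∀ t ∈ Icc a b,
    caputoDeriv a b (1 / lcmDen α) (X i) t = X j t
  equation : ∀ j : Fin (dim α), (j : ℕ) + 1 = dim α → ∀ t ∈ Icc a b,
    caputoDeriv a b (1 / lcmDen α) (X j) t = f t (fun i => X (termIndex α h0 hα i) t)
  initial : ∀ j : Fin (dim α), X j a = if lcmDen α ∣ (j : ℕ) then ξ (j / lcmDen α) else 0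

end Caputo

end

open Set

noncomputable section

namespace Caputo

/-! Both problems are equivalent to one Volterra integral equation. Write γ = 1/M. A chain is a
family with u_j = c_j + J^γ u_{j+1} for j < N, where c_j is the initial value of x_j in (B). By the
semigroup law it is determined by its last member g = u_N, since u_j is a combination of powers of t
- a plus J^{(N-j)γ} g. Because c_j = 0 unless M divides j, the powers in u_0 have integer exponents
and form a Taylor polynomial with the prescribed data. The Caputo derivative of u_0 of order jγ is
therefore u_j.

The bridge between derivatives and integrals is that D^α x = g with g continuous means x = T + J^α
g, with T the Taylor polynomial (`contCaputoDiff_of_repr`, `ContCaputoDiff.repr`). Hence solutions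
of (A) and of (B) both correspond to chains closed by u_N = f(t, u_0, u_{α_1/γ}, …). In terms of g
this closure is g = f(t, p_i + J^{β_i} g) with every β_i > 0; `existsUnique_volterra` solves it by a
contraction in an exponentially weighted sup norm. -/

/-! ### Linearity and monotonicity of fractional integrals -/

theorem rlIntegral_zero (a : ℝ) (f : ℝ → ℝ) : rlIntegral a 0 f = f := by
  ext; simp [rlIntegral]

theorem rlIntegral_of_pos {a α : ℝ} (hα : 0 < α) (f : ℝ → ℝ) (x : ℝ) :
    rlIntegral a α f x = 1 / Real.Gamma α * ∫ t in a..x, (x - t) ^ (α - 1) * f t := by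
  simp [rlIntegral, hα.ne']

theorem rlIntegral_self {a α : ℝ} (hα : 0 < α) (f : ℝ → ℝ) : rlIntegral a α f a = 0 := by
  simp [rlIntegral_of_pos hα]

theorem rlIntegral_one (a : ℝ) (f : ℝ → ℝ) (x : ℝ) : rlIntegral a 1 f x = ∫ t in a..x, f t := by
  simp [rlIntegral]

theorem rlIntegral_congr {a b : ℝ} (α : ℝ) {f g : ℝ → ℝ} (h : EqOn f g (Icc a b)) :
    EqOn (rlIntegral a α f) (rlIntegral a α g) (Icc a b) := by
  intro x hx
  unfold rlIntegral
  split_ifs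
  · exact h hx
  · congr 1
    refine intervalIntegral.integral_congr fun t ht => ?_
    rw [uIcc_of_le hx.1] at ht
    simp only [h ⟨ht.1, ht.2.trans hx.2⟩]

theorem intervalIntegrable_kernel (a x : ℝ) {α : ℝ} (hα : 0 < α) :
    IntervalIntegrable (fun t => (x - t) ^ (α - 1)) MeasureTheory.volume a x := by
  have h := (intervalIntegral.intervalIntegrable_rpow' (a := x - a) (b := 0)
    (r := α - 1) (by linarith)).comp_sub_left x
  simpa using h

theorem intervalIntegrable_kernel_mul {a b x α : ℝ} (hα : 0 < α) (hx : x ∈ Icc a b) {f : ℝ → ℝ}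
    (hf : ContinuousOn f (Icc a b)) :
    IntervalIntegrable (fun t => (x - t) ^ (α - 1) * f t) MeasureTheory.volume a x := by
  refine (intervalIntegrable_kernel a x hα).mul_continuousOn (hf.mono ?_)
  rw [uIcc_of_le hx.1]
  exact Icc_subset_Icc_right hx.2

theorem rlIntegral_add {a b x α : ℝ} (hα : 0 ≤ α) (hx : x ∈ Icc a b) {f g : ℝ → ℝ}
    (hf : ContinuousOn f (Icc a b)) (hg : ContinuousOn g (Icc a b)) :
    rlIntegral a α (fun t => f t + g t) x = rlIntegral a α f x + rlIntegral a α g x := by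
  rcases hα.eq_or_lt with rfl | hα
  · simp [rlIntegral_zero]
  · simp only [rlIntegral_of_pos hα, mul_add]
    rw [intervalIntegral.integral_add (intervalIntegrable_kernel_mul hα hx hf)
      (intervalIntegrable_kernel_mul hα hx hg), mul_add]

theorem rlIntegral_const_mul (a α c : ℝ) (f : ℝ → ℝ) (x : ℝ) :
    rlIntegral a α (fun t => c * f t) x = c * rlIntegral a α f x := by
  unfold rlIntegral
  split_ifs
  · rfl
  · simp only [mul_left_comm _ c, intervalIntegral.integral_const_mul]

theorem rlIntegral_sub {a b x α : ℝ} (hα : 0 ≤ α) (hx : x ∈ Icc a b) {f g : ℝ → ℝ}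
    (hf : ContinuousOn f (Icc a b)) (hg : ContinuousOn g (Icc a b)) :
    rlIntegral a α (fun t => f t - g t) x = rlIntegral a α f x - rlIntegral a α g x := by
  have h := rlIntegral_add hα hx hf (g := fun t => -1 * g t) (continuousOn_const.mul hg)
  rw [rlIntegral_const_mul] at h
  simpa [sub_eq_add_neg] using h

theorem rlIntegral_sum {a b x α : ℝ} (hα : 0 ≤ α) (hx : x ∈ Icc a b) {ι : Type*} (s : Finset ι)
    (c : ι → ℝ) {f : ι → ℝ → ℝ} (hf : ∀ i ∈ s, ContinuousOn (f i) (Icc a b)) :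
    rlIntegral a α (fun t => ∑ i ∈ s, c i * f i t) x = ∑ i ∈ s, c i * rlIntegral a α (f i) x := by
  classical
  induction s using Finset.induction_on with
  | empty => simpa using rlIntegral_const_mul a α 0 (fun _ => 0) x
  | insert i s hi ih =>
    have hfs : ∀ j ∈ s, ContinuousOn (f j) (Icc a b) :=
      fun j hj => hf j (Finset.mem_insert_of_mem hj)
    simp only [Finset.sum_insert hi]
    rw [rlIntegral_add hα hx (continuousOn_const.fun_mul (hf i (Finset.mem_insert_self i s)))
      (continuousOn_finsetSum _ fun j hj => continuousOn_const.fun_mul (hfs j hj)),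
      rlIntegral_const_mul, ih hfs]

theorem rlIntegral_mono {a b x α : ℝ} (hα : 0 ≤ α) (hx : x ∈ Icc a b) {f g : ℝ → ℝ}
    (hf : ContinuousOn f (Icc a b)) (hg : ContinuousOn g (Icc a b))
    (h : ∀ t ∈ Icc a b, f t ≤ g t) : rlIntegral a α f x ≤ rlIntegral a α g x := by
  rcases hα.eq_or_lt with rfl | hα
  · simpa [rlIntegral_zero] using h x hx
  · simp only [rlIntegral_of_pos hα]
    refine mul_le_mul_of_nonneg_left ?_ (one_div_nonneg.2 (Real.Gamma_pos_of_pos hα).le)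
    refine intervalIntegral.integral_mono_on hx.1 (intervalIntegrable_kernel_mul hα hx hf)
      (intervalIntegrable_kernel_mul hα hx hg) fun t ht => ?_
    exact mul_le_mul_of_nonneg_left (h t ⟨ht.1, ht.2.trans hx.2⟩)
      (Real.rpow_nonneg (sub_nonneg.2 ht.2) _)

theorem abs_rlIntegral_le {a b x α : ℝ} (hα : 0 ≤ α) (hx : x ∈ Icc a b) {f g : ℝ → ℝ}
    (hf : ContinuousOn f (Icc a b)) (hg : ContinuousOn g (Icc a b))
    (h : ∀ t ∈ Icc a b, |f t| ≤ g t) : |rlIntegral a α f x| ≤ rlIntegral a α g x := by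
  rw [abs_le]
  refine ⟨?_, rlIntegral_mono hα hx hf hg fun t ht => (abs_le.1 (h t ht)).2⟩
  have h' := rlIntegral_mono hα hx (f := fun t => -1 * g t) (continuousOn_const.mul hg) hf
    fun t ht => by linarith [(abs_le.1 (h t ht)).1]
  rw [rlIntegral_const_mul] at h'
  linarith

/-! ### The Beta integral and fractional integrals of powers -/

theorem integral_sub_rpow_mul_rpow {y u v : ℝ} (hy : 0 < y) (hu : 0 < u) (hv : 0 < v) :
    ∫ s in (0 : ℝ)..y, (y - s) ^ (v - 1) * s ^ (u - 1) =
      Real.Gamma u * Real.Gamma v / Real.Gamma (u + v) * y ^ (u + v - 1) := by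
  have h := Complex.betaIntegral_scaled u v hy
  rw [Complex.betaIntegral_eq_Gamma_mul_div _ _ (by simpa) (by simpa), ← Complex.ofReal_add,
    Complex.Gamma_ofReal, Complex.Gamma_ofReal, Complex.Gamma_ofReal] at h
  rw [← Complex.ofReal_inj, ← intervalIntegral.integral_ofReal]
  refine (intervalIntegral.integral_congr fun s hs => ?_).trans (h.trans ?_)
  · rw [uIcc_of_le hy.le] at hs
    have h1 : 0 ≤ y - s := sub_nonneg.2 hs.2
    simp only [Complex.ofReal_mul, Complex.ofReal_cpow h1, Complex.ofReal_cpow hs.1]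
    push_cast
    ring
  · push_cast [Complex.ofReal_cpow hy.le]
    ring

theorem rlIntegral_rpow {a x α ν : ℝ} (hα : 0 ≤ α) (hν : 0 ≤ ν) (hx : a ≤ x) :
    rlIntegral a α (fun t => (t - a) ^ ν) x =
      Real.Gamma (ν + 1) / Real.Gamma (ν + α + 1) * (x - a) ^ (ν + α) := by
  have hΓ : 0 < Real.Gamma (ν + 1) := Real.Gamma_pos_of_pos (by linarith)
  rcases hα.eq_or_lt with rfl | hα
  · simp [rlIntegral_zero, hΓ.ne']
  rcases hx.eq_or_lt with rfl | hx
  · rw [rlIntegral_self hα, sub_self, Real.zero_rpow (by linarith), mul_zero]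
  · have hΓ' : 0 < Real.Gamma α := Real.Gamma_pos_of_pos hα
    have h := integral_sub_rpow_mul_rpow (sub_pos.2 hx) (u := ν + 1) (by linarith) hα
    rw [rlIntegral_of_pos hα]
    have h2 := intervalIntegral.integral_comp_sub_right (a := a) (b := x)
      (fun s => (x - a - s) ^ (α - 1) * s ^ (ν + 1 - 1)) a
    simp only [sub_sub_sub_cancel_right, sub_self] at h2
    rw [add_sub_cancel_right] at h h2
    rw [h2, h, show ν + 1 + α - 1 = ν + α by ring, show ν + 1 + α = ν + α + 1 by ring]
    field_simp

/-- The powers `(t - a)^ν / Γ(ν + 1)`. -/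
def gammaPow (a ν t : ℝ) : ℝ := (t - a) ^ ν / Real.Gamma (ν + 1)

theorem gammaPow_zero (a t : ℝ) : gammaPow a 0 t = 1 := by simp [gammaPow]

theorem gammaPow_natCast (a : ℝ) (n : ℕ) (t : ℝ) :
    gammaPow a n t = (t - a) ^ n / n.factorial := by
  simp [gammaPow, Real.Gamma_nat_eq_factorial]

theorem continuous_gammaPow (a : ℝ) {ν : ℝ} (hν : 0 ≤ ν) : Continuous (gammaPow a ν) := by
  unfold gammaPow
  exact ((continuous_id.sub continuous_const).rpow_const fun _ => Or.inr hν).div_const _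

/-- The Gamma factor in `gammaPow` absorbs the Beta integral, so that integration only shifts the
exponent. -/
theorem rlIntegral_gammaPow {a x α ν : ℝ} (hα : 0 ≤ α) (hν : 0 ≤ ν) (hx : a ≤ x) :
    rlIntegral a α (gammaPow a ν) x = gammaPow a (ν + α) x := by
  have hΓ : 0 < Real.Gamma (ν + 1) := Real.Gamma_pos_of_pos (by linarith)
  have h := rlIntegral_const_mul a α (1 / Real.Gamma (ν + 1)) (fun t => (t - a) ^ ν) x
  rw [rlIntegral_rpow hα hν hx] at h
  have h' : gammaPow a ν = fun t => 1 / Real.Gamma (ν + 1) * (t - a) ^ ν := by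
    ext t; simp only [gammaPow]; ring
  rw [h', h, gammaPow]
  field_simp

/-! ### Uniform bounds, continuity, semigroup law and exponential growth -/

theorem abs_rlIntegral_le_const {a b α : ℝ} (hα : 0 ≤ α) :
    ∃ C, 0 < C ∧ ∀ (f : ℝ → ℝ) (B : ℝ), ContinuousOn f (Icc a b) → 0 ≤ B →
      (∀ t ∈ Icc a b, |f t| ≤ B) → ∀ x ∈ Icc a b, |rlIntegral a α f x| ≤ C * B := by
  have hΓ : 0 < Real.Gamma (α + 1) := Real.Gamma_pos_of_pos (by linarith)
  -- The summand 1 keeps the constant positive even when a = b, so that later errors can be divided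
  -- by it.
  refine ⟨|b - a| ^ α / Real.Gamma (α + 1) + 1, by positivity, fun f B hf hB h x hx => ?_⟩
  have h1 : |rlIntegral a α f x| ≤ rlIntegral a α (fun t => B * gammaPow a 0 t) x :=
    abs_rlIntegral_le hα hx hf (continuous_const.mul
      (continuous_gammaPow a le_rfl)).continuousOn fun t ht => by
        simpa [gammaPow_zero] using h t ht
  rw [rlIntegral_const_mul, rlIntegral_gammaPow hα le_rfl hx.1, zero_add, gammaPow] at h1
  refine h1.trans ?_
  rw [mul_comm]
  refine mul_le_mul_of_nonneg_right ?_ hB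
  have h2 : (x - a) ^ α ≤ |b - a| ^ α := Real.rpow_le_rpow (sub_nonneg.2 hx.1)
    ((sub_le_sub_right hx.2 a).trans (le_abs_self _)) hα
  have h3 := div_le_div_of_nonneg_right h2 hΓ.le
  linarith

/-- Weierstrass approximation, recentred at a. Both continuity and the semigroup law reduce through
it to explicit powers. -/
theorem exists_sum_gammaPow_near {a b : ℝ} {f : ℝ → ℝ} (hf : ContinuousOn f (Icc a b)) {ε : ℝ}
    (hε : 0 < ε) : ∃ (n : ℕ) (c : ℕ → ℝ), ∀ t ∈ Icc a b,
      |f t - ∑ i ∈ Finset.range n, c i * gammaPow a i t| ≤ ε := by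
  obtain ⟨p, hp⟩ := exists_polynomial_near_of_continuousOn a b f hf ε hε
  refine ⟨(p.comp (Polynomial.X + Polynomial.C a)).natDegree + 1,
    fun i => (p.comp (Polynomial.X + Polynomial.C a)).coeff i * i.factorial, fun t ht => ?_⟩
  have h : p.eval t = (p.comp (Polynomial.X + Polynomial.C a)).eval (t - a) := by simp
  rw [Polynomial.eval_eq_sum_range (p := p.comp _)] at h
  have h' : ∀ i : ℕ, (p.comp (Polynomial.X + Polynomial.C a)).coeff i * i.factorial *
      gammaPow a i t = (p.comp (Polynomial.X + Polynomial.C a)).coeff i * (t - a) ^ i := by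
    intro i
    rw [gammaPow_natCast]
    have : (i.factorial : ℝ) ≠ 0 := by positivity
    field_simp
  simp only [h']
  rw [← h, abs_sub_comm]
  exact (hp t ht).le

theorem rlIntegral_sum_gammaPow {a b α : ℝ} (hα : 0 ≤ α) (n : ℕ) (c : ℕ → ℝ) {ν : ℕ → ℝ}
    (hν : ∀ i, 0 ≤ ν i) {x : ℝ} (hx : x ∈ Icc a b) :
    rlIntegral a α (fun t => ∑ i ∈ Finset.range n, c i * gammaPow a (ν i) t) x =
      ∑ i ∈ Finset.range n, c i * gammaPow a (ν i + α) x := by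
  rw [rlIntegral_sum hα hx _ _ fun i _ => (continuous_gammaPow a (hν i)).continuousOn]
  exact Finset.sum_congr rfl fun i _ => by rw [rlIntegral_gammaPow hα (hν i) hx.1]

theorem continuous_sum_gammaPow (a : ℝ) (n : ℕ) (c : ℕ → ℝ) {ν : ℕ → ℝ} (hν : ∀ i, 0 ≤ ν i) :
    Continuous fun t => ∑ i ∈ Finset.range n, c i * gammaPow a (ν i) t :=
  continuous_finsetSum _ fun i _ => continuous_const.mul (continuous_gammaPow a (hν i))

/-- The integral of a polynomial is an explicit sum of continuous powers, and J^α is bounded in the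
sup norm; so J^α f is a uniform limit of continuous functions. -/
theorem continuousOn_rlIntegral {a b α : ℝ} (hα : 0 ≤ α) {f : ℝ → ℝ}
    (hf : ContinuousOn f (Icc a b)) : ContinuousOn (rlIntegral a α f) (Icc a b) := by
  obtain ⟨C, hC, hbound⟩ := abs_rlIntegral_le_const (a := a) (b := b) hα
  refine continuousOn_of_uniform_approx_of_continuousOn fun u hu => ?_
  obtain ⟨ε, hε, hu⟩ := Metric.mem_uniformity_dist.1 hu
  obtain ⟨n, c, hc⟩ := exists_sum_gammaPow_near hf (ε := ε / (2 * C)) (by positivity)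
  have hcont := (continuous_sum_gammaPow a n c (ν := fun i => i) fun i => i.cast_nonneg).continuousOn
    (s := Icc a b)
  refine ⟨fun x => ∑ i ∈ Finset.range n, c i * gammaPow a (i + α) x,
    (continuous_sum_gammaPow a n c fun i => by positivity).continuousOn, fun x hx => hu ?_⟩
  have h := hbound _ _ (hf.fun_sub hcont) (by positivity) hc x hx
  rw [rlIntegral_sub hα hx hf hcont, rlIntegral_sum_gammaPow hα n c (fun i => i.cast_nonneg) hx] at h
  rw [Real.dist_eq]
  refine h.trans_lt ?_
  rw [mul_div_assoc', mul_comm C, mul_div_mul_right _ _ hC.ne']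
  linarith

/-- The semigroup property of the fractional integrals. -/
theorem rlIntegral_rlIntegral {a b α β : ℝ} (hα : 0 ≤ α) (hβ : 0 ≤ β) {f : ℝ → ℝ}
    (hf : ContinuousOn f (Icc a b)) :
    EqOn (rlIntegral a α (rlIntegral a β f)) (rlIntegral a (β + α) f) (Icc a b) := by
  intro x hx
  obtain ⟨A, hA, hboundA⟩ := abs_rlIntegral_le_const (a := a) (b := b) hα
  obtain ⟨B, hB, hboundB⟩ := abs_rlIntegral_le_const (a := a) (b := b) hβ
  obtain ⟨C, hC, hboundC⟩ := abs_rlIntegral_le_const (a := a) (b := b) (add_nonneg hβ hα)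
  -- Both sides agree on powers of t - a and are bounded in the sup norm, so no interchange of
  -- integrals is needed. An approximation error δ contributes A * B * δ on the left and C * δ on
  -- the right; δ is chosen so that these add up to ε.
  refine eq_of_abs_sub_le_all fun ε hε => ?_
  obtain ⟨n, c, hc⟩ := exists_sum_gammaPow_near hf (ε := ε / (A * B + C)) (by positivity)
  have hcont := (continuous_sum_gammaPow a n c (ν := fun i => i) fun i => i.cast_nonneg).continuousOn
    (s := Icc a b)
  have hcont' := (continuous_sum_gammaPow a n c (ν := fun i => i + β)
    fun i => by positivity).continuousOn (s := Icc a b)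
  have hBf : ∀ t ∈ Icc a b, |rlIntegral a β f t -
      ∑ i ∈ Finset.range n, c i * gammaPow a (i + β) t| ≤ B * (ε / (A * B + C)) := by
    intro t ht
    have h := hboundB _ _ (hf.fun_sub hcont) (by positivity) hc t ht
    rwa [rlIntegral_sub hβ ht hf hcont,
      rlIntegral_sum_gammaPow hβ n c (fun i => i.cast_nonneg) ht] at h
  have h1 := hboundA _ _ ((continuousOn_rlIntegral hβ hf).fun_sub hcont') (by positivity) hBf x hx
  rw [rlIntegral_sub hα hx (continuousOn_rlIntegral hβ hf) hcont',
    rlIntegral_sum_gammaPow hα n c (fun i => by positivity) hx] at h1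
  have h2 := hboundC _ _ (hf.fun_sub hcont) (by positivity) hc x hx
  rw [rlIntegral_sub (add_nonneg hβ hα) hx hf hcont,
    rlIntegral_sum_gammaPow (add_nonneg hβ hα) n c (fun i => i.cast_nonneg) hx] at h2
  simp only [add_assoc] at h1
  have h3 : A * (B * (ε / (A * B + C))) + C * (ε / (A * B + C)) = ε := by
    field_simp
  rw [abs_le] at *
  constructor <;> linarith [h1.1, h1.2, h2.1, h2.2]

/-- The substitution u = x - t leaves a truncated Gamma integral, bounded by the full one. The
factor λ^(-β) tends to 0 as λ grows, which later yields the contraction. -/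
theorem rlIntegral_exp_le {a x β lam : ℝ} (hβ : 0 < β) (hlam : 0 < lam) (hx : a ≤ x) :
    rlIntegral a β (fun t => Real.exp (lam * (t - a))) x ≤
      (1 / lam) ^ β * Real.exp (lam * (x - a)) := by
  have hΓ : 0 < Real.Gamma β := Real.Gamma_pos_of_pos hβ
  have hI := Real.integral_rpow_mul_exp_neg_mul_Ioi hβ hlam
  have hint : MeasureTheory.IntegrableOn
      (fun t : ℝ => t ^ (β - 1) * Real.exp (-(lam * t))) (Ioi 0) := by
    -- A non-integrable function has integral 0 by convention, but the known value is positive.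
    by_contra h
    rw [MeasureTheory.integral_undef h] at hI
    have : 0 < (1 / lam) ^ β * Real.Gamma β := by positivity
    linarith
  have h1 : ∫ t in a..x, (x - t) ^ (β - 1) * Real.exp (lam * (t - a)) =
      Real.exp (lam * (x - a)) * ∫ u in (0 : ℝ)..(x - a), u ^ (β - 1) * Real.exp (-(lam * u)) := by
    have h := intervalIntegral.integral_comp_sub_left (a := a) (b := x)
      (fun u => u ^ (β - 1) * Real.exp (-(lam * u))) x
    rw [sub_self] at h
    rw [← h, ← intervalIntegral.integral_const_mul]
    refine intervalIntegral.integral_congr fun t _ => ?_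
    rw [show lam * (t - a) = lam * (x - a) + -(lam * (x - t)) by ring, Real.exp_add]
    ring
  have h2 : ∫ u in (0 : ℝ)..(x - a), u ^ (β - 1) * Real.exp (-(lam * u)) ≤
      (1 / lam) ^ β * Real.Gamma β := by
    rw [← hI, intervalIntegral.integral_of_le (sub_nonneg.2 hx)]
    refine MeasureTheory.setIntegral_mono_set hint ?_ (Ioc_subset_Ioi_self.eventuallyLE)
    refine (MeasureTheory.ae_restrict_mem measurableSet_Ioi).mono fun t ht => ?_
    exact mul_nonneg (Real.rpow_nonneg (le_of_lt ht) _) (Real.exp_pos _).le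
  rw [rlIntegral_of_pos hβ, h1, one_div_mul_eq_div, div_le_iff₀ hΓ]
  refine (mul_le_mul_of_nonneg_left h2 (Real.exp_pos _).le).trans_eq ?_
  ring

/-! ### Differentiation of fractional integrals and of Taylor polynomials -/

theorem hasDerivWithinAt_rlIntegral_one {a b : ℝ} {f : ℝ → ℝ} (hf : ContinuousOn f (Icc a b))
    {x : ℝ} (hx : x ∈ Icc a b) : HasDerivWithinAt (rlIntegral a 1 f) (f x) (Icc a b) x := by
  have hint : IntervalIntegrable f MeasureTheory.volume a x := by
    refine (hf.mono ?_).intervalIntegrable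
    rw [uIcc_of_le hx.1]
    exact Icc_subset_Icc_right hx.2
  -- Supplies the `FTCFilter` instance for differentiation within `Icc a b`, endpoints included.
  have : Fact (x ∈ Icc a b) := ⟨hx⟩
  have h := intervalIntegral.integral_hasDerivWithinAt_right hint (s := Icc a b) (t := Icc a b)
    (hf.stronglyMeasurableAtFilter_nhdsWithin measurableSet_Icc x) (hf x hx)
  exact h.congr_of_mem (fun y _ => rlIntegral_one a f y) hx

theorem hasDerivWithinAt_rlIntegral_add_one {a b β : ℝ} (hβ : 0 ≤ β) {f : ℝ → ℝ}
    (hf : ContinuousOn f (Icc a b)) {x : ℝ} (hx : x ∈ Icc a b) :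
    HasDerivWithinAt (rlIntegral a (β + 1) f) (rlIntegral a β f x) (Icc a b) x :=
  (hasDerivWithinAt_rlIntegral_one (continuousOn_rlIntegral hβ hf) hx).congr_of_mem
    (fun _ hy => (rlIntegral_rlIntegral zero_le_one hβ hf hy).symm) hx

/-- A `C^(n + 1)` criterion on `[a,b]` in terms of a given derivative. -/
theorem contDiffOn_succ_of_hasDerivWithinAt {a b : ℝ} (hab : a < b) {n : ℕ} {f f' : ℝ → ℝ}
    (hf : ∀ x ∈ Icc a b, HasDerivWithinAt f (f' x) (Icc a b) x) (hf' : ContDiffOn ℝ n f' (Icc a b)) :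
    ContDiffOn ℝ (n + 1 : ℕ) f (Icc a b) := by
  have hu := uniqueDiffOn_Icc hab
  push_cast
  rw [contDiffOn_succ_iff_derivWithin hu]
  refine ⟨fun x hx => (hf x hx).differentiableWithinAt, by simp, hf'.congr fun x hx => ?_⟩
  exact (hf x hx).derivWithin (hu x hx)

theorem iteratedDerivWithin_succ_eqOn {a b : ℝ} (hab : a < b) {n : ℕ} {f f' : ℝ → ℝ}
    (hf : ∀ x ∈ Icc a b, HasDerivWithinAt f (f' x) (Icc a b) x) :
    EqOn (iteratedDerivWithin (n + 1) f (Icc a b)) (iteratedDerivWithin n f' (Icc a b))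
      (Icc a b) := by
  rw [iteratedDerivWithin_succ']
  exact iteratedDerivWithin_congr
    fun x hx => (hf x hx).derivWithin (uniqueDiffOn_Icc hab x hx)

theorem contDiffOn_rlIntegral_nat {a b : ℝ} (hab : a < b) (m : ℕ) {f : ℝ → ℝ}
    (hf : ContinuousOn f (Icc a b)) : ContDiffOn ℝ m (rlIntegral a m f) (Icc a b) ∧
      EqOn (iteratedDerivWithin m (rlIntegral a m f) (Icc a b)) f (Icc a b) := by
  induction m with
  | zero => simpa [rlIntegral_zero] using ⟨hf, fun _ _ => rfl⟩
  | succ m ih =>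
    have h : ∀ x ∈ Icc a b, HasDerivWithinAt (rlIntegral a (m + 1 : ℕ) f)
        (rlIntegral a m f x) (Icc a b) x := fun x hx => by
      push_cast
      exact hasDerivWithinAt_rlIntegral_add_one m.cast_nonneg hf hx
    exact ⟨contDiffOn_succ_of_hasDerivWithinAt hab h ih.1,
      (iteratedDerivWithin_succ_eqOn hab h).trans ih.2⟩

theorem hasDerivWithinAt_sum_range_succ (a : ℝ) (s : Set ℝ) (n : ℕ) (c : ℕ → ℝ) (x : ℝ) :
    HasDerivWithinAt (fun t => ∑ i ∈ Finset.range (n + 1), c i * gammaPow a i t)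
      (∑ i ∈ Finset.range n, c (i + 1) * gammaPow a i x) s x := by
  simp only [Finset.sum_range_succ', gammaPow_natCast]
  have h : ∀ i ∈ Finset.range n, HasDerivWithinAt
      (fun t => c (i + 1) * ((t - a) ^ (i + 1) / (i + 1).factorial))
      (c (i + 1) * ((x - a) ^ i / i.factorial)) s x := fun i _ => by
    have h1 := ((((hasDerivAt_id x).sub_const a).pow (i + 1)).div_const
      ((i + 1).factorial : ℝ)).const_mul (c (i + 1))
    refine (h1.congr_deriv ?_).hasDerivWithinAt
    have h2 : (i.factorial : ℝ) ≠ 0 := by positivity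
    have h3 : (i + 1 : ℝ) ≠ 0 := by positivity
    simp only [id, Nat.factorial_succ, add_tsub_cancel_right]
    push_cast
    field_simp
  simpa using (HasDerivWithinAt.fun_sum h).add_const (c 0)

theorem sum_gammaPow_self (a : ℝ) (n : ℕ) (c : ℕ → ℝ) :
    ∑ i ∈ Finset.range (n + 1), c i * gammaPow a i a = c 0 := by
  rw [Finset.sum_range_succ', Finset.sum_eq_zero fun i _ => by
    rw [gammaPow_natCast]
    simp]
  simp [gammaPow_zero]

/-- Smoothness and the initial derivatives of a Taylor polynomial plus a fractional integral. -/
theorem contDiffOn_of_repr {a b : ℝ} (hab : a < b) (n : ℕ) {β : ℝ} (hβ : n < β) (c : ℕ → ℝ)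
    {g x : ℝ → ℝ} (hg : ContinuousOn g (Icc a b))
    (hx : ∀ t ∈ Icc a b,
      x t = ∑ i ∈ Finset.range (n + 1), c i * gammaPow a i t + rlIntegral a β g t) :
    ContDiffOn ℝ n x (Icc a b) ∧ ∀ i ≤ n, iteratedDerivWithin i x (Icc a b) a = c i := by
  have ha : a ∈ Icc a b := left_mem_Icc.2 hab.le
  induction n generalizing β c x with
  | zero =>
    have hβ0 : 0 < β := by simpa using hβ
    refine ⟨?_, fun i hi => ?_⟩
    · have h : ContinuousOn x (Icc a b) :=
        ((continuous_sum_gammaPow a (0 + 1) c fun i => i.cast_nonneg).continuousOn.add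
          (continuousOn_rlIntegral hβ0.le hg)).congr hx
      simpa using h
    · obtain rfl : i = 0 := by omega
      rw [iteratedDerivWithin_zero, hx a ha, sum_gammaPow_self, rlIntegral_self hβ0, add_zero]
  | succ n ih =>
    push_cast at hβ
    have hβ0 : 0 < β := by linarith [n.cast_nonneg (α := ℝ)]
    have h : ∀ t ∈ Icc a b, HasDerivWithinAt x (∑ i ∈ Finset.range (n + 1),
        c (i + 1) * gammaPow a i t + rlIntegral a (β - 1) g t) (Icc a b) t := fun t ht => by
      have h2 := hasDerivWithinAt_rlIntegral_add_one (β := β - 1)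
        (by linarith [n.cast_nonneg (α := ℝ)]) hg ht
      rw [sub_add_cancel] at h2
      exact ((hasDerivWithinAt_sum_range_succ a _ (n + 1) c t).add h2).congr_of_mem hx ht
    -- Differentiation preserves the form: the coefficients shift by one and n, β both drop by one.
    -- The order of the integral stays positive, so it contributes nothing at a.
    obtain ⟨h1, h2⟩ := ih (β := β - 1) (by linarith) (fun i => c (i + 1)) (fun t _ => rfl)
    refine ⟨contDiffOn_succ_of_hasDerivWithinAt hab h h1, fun i hi => ?_⟩
    cases i with
    | zero => rw [iteratedDerivWithin_zero, hx a ha, sum_gammaPow_self, rlIntegral_self hβ0,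
        add_zero]
    | succ i => rw [iteratedDerivWithin_succ_eqOn hab h ha, h2 i (by omega)]

/-- A `C^n` function with vanishing initial derivatives is the `n`-fold integral of its `n`-th
derivative. -/
theorem eqOn_rlIntegral_iteratedDerivWithin {a b : ℝ} (hab : a < b) (n : ℕ) {y : ℝ → ℝ}
    (hy : ContDiffOn ℝ n y (Icc a b)) (h0 : ∀ i < n, iteratedDerivWithin i y (Icc a b) a = 0) :
    EqOn y (rlIntegral a n (iteratedDerivWithin n y (Icc a b))) (Icc a b) := by
  have hu := uniqueDiffOn_Icc hab
  induction n generalizing y with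
  | zero => intro t _; simp [rlIntegral_zero]
  | succ n ih =>
    have hcont : ContinuousOn (iteratedDerivWithin (n + 1) y (Icc a b)) (Icc a b) :=
      hy.continuousOn_iteratedDerivWithin le_rfl hu
    have hy' := hy
    push_cast at hy'
    rw [contDiffOn_succ_iff_derivWithin hu] at hy'
    have h1 := ih hy'.2.2 fun i hi => by
      rw [← iteratedDerivWithin_succ']
      exact h0 _ (by omega)
    rw [← iteratedDerivWithin_succ'] at h1
    intro t ht
    have h2 : ∫ s in a..t, derivWithin y (Icc a b) s = y t - y a := by
      refine intervalIntegral.integral_eq_sub_of_hasDeriv_right_of_le ht.1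
        (hy.continuousOn.mono (Icc_subset_Icc_right ht.2)) (fun s hs => ?_) ?_
      · have hs' : s ∈ Ioo a b := ⟨hs.1, hs.2.trans_le ht.2⟩
        exact ((hy'.1 s (Ioo_subset_Icc_self hs')).hasDerivWithinAt.hasDerivAt
          (Icc_mem_nhds hs'.1 hs'.2)).hasDerivWithinAt
      · refine (hy'.2.2.continuousOn.mono ?_).intervalIntegrable
        rw [uIcc_of_le ht.1]
        exact Icc_subset_Icc_right ht.2
    have h3 : y a = 0 := by simpa using h0 0 (by omega)
    rw [h3, sub_zero, ← rlIntegral_one, rlIntegral_congr 1 h1 ht,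
      rlIntegral_rlIntegral zero_le_one n.cast_nonneg hcont ht] at h2
    push_cast
    exact h2.symm

/-! ### Caputo derivatives and integral representations -/

theorem taylorWithinEval_eq_sum_gammaPow (f : ℝ → ℝ) (n : ℕ) (s : Set ℝ) (a t : ℝ) :
    taylorWithinEval f n s a t =
      ∑ i ∈ Finset.range (n + 1), iteratedDerivWithin i f s a * gammaPow a i t := by
  rw [taylor_within_apply]
  refine Finset.sum_congr rfl fun i _ => ?_
  rw [gammaPow_natCast, smul_eq_mul]
  ring

/-- A Taylor polynomial plus the fractional integral of order `α` of a continuous function `g` has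
Caputo derivative `g` of order `α`. -/
theorem contCaputoDiff_of_repr {a b : ℝ} (hab : a < b) {α : ℝ} (hα : 0 ≤ α) (c : ℕ → ℝ)
    {g x : ℝ → ℝ} (hg : ContinuousOn g (Icc a b))
    (hx : ∀ t ∈ Icc a b,
      x t = ∑ i ∈ Finset.range ⌈α⌉₊, c i * gammaPow a i t + rlIntegral a α g t) :
    ContCaputoDiff a b α x ∧ EqOn (caputoDeriv a b α x) g (Icc a b) ∧
      ∀ i < ⌈α⌉₊, iteratedDerivWithin i x (Icc a b) a = c i := by
  rcases hα.eq_or_lt with rfl | hα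
  · have h : EqOn x g (Icc a b) := fun t ht => by simpa [rlIntegral_zero] using hx t ht
    refine ⟨by simpa [ContCaputoDiff] using hg.congr h, fun t ht => ?_, by simp⟩
    simpa [caputoDeriv] using h ht
  obtain ⟨n, hn⟩ : ∃ n, ⌈α⌉₊ = n + 1 :=
    Nat.exists_eq_succ_of_ne_zero (Nat.ceil_pos.2 hα).ne'
  have hnα : (n : ℝ) < α := Nat.lt_ceil.1 (by omega)
  have hαn : α ≤ n + 1 := by simpa [hn] using Nat.le_ceil α
  rw [hn] at hx
  obtain ⟨h1, h2⟩ := contDiffOn_of_repr hab n hnα c hg hx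
  -- Removing the Taylor polynomial leaves J^α g; then J^{m-α} J^α g = J^m g, whose m-th derivative
  -- is g.
  have h3 : EqOn (subTaylor a b α x) (rlIntegral a α g) (Icc a b) := fun t ht => by
    rw [subTaylor, taylorWithinEval_eq_sum_gammaPow, hn, add_tsub_cancel_right, hx t ht,
      sub_eq_iff_eq_add', add_left_inj]
    exact Finset.sum_congr rfl fun i hi => by rw [h2 i (by simpa [Nat.lt_succ_iff] using hi)]
  have h4 : EqOn (rlIntegral a (⌈α⌉₊ - α) (subTaylor a b α x)) (rlIntegral a ⌈α⌉₊ g)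
      (Icc a b) := fun t ht => by
    rw [rlIntegral_congr _ h3 ht, rlIntegral_rlIntegral (sub_nonneg.2 (Nat.le_ceil α)) hα.le hg ht,
      add_sub_cancel]
  obtain ⟨h5, h6⟩ := contDiffOn_rlIntegral_nat hab ⌈α⌉₊ hg
  refine ⟨?_, fun t ht => ?_, fun i hi => h2 i (by omega)⟩
  · rw [ContCaputoDiff, if_neg hα.ne']
    refine ⟨by simpa [hn] using h1, (continuousOn_rlIntegral hα.le hg).congr h3, fun _ => ?_⟩
    exact h5.congr h4
  · rw [caputoDeriv, if_neg hα.ne', rlDeriv, if_neg hα.ne', iteratedDerivWithin_congr h4 ht, h6 ht]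

/-- A continuously Caputo `α`-differentiable function is the sum of its Taylor polynomial and the
fractional integral of order `α` of its Caputo derivative. -/
theorem ContCaputoDiff.repr {a b : ℝ} (hab : a < b) {α : ℝ} (hα : 0 ≤ α) {x : ℝ → ℝ}
    (h : ContCaputoDiff a b α x) : ContinuousOn (caputoDeriv a b α x) (Icc a b) ∧
      ∀ t ∈ Icc a b, x t = ∑ i ∈ Finset.range ⌈α⌉₊,
        iteratedDerivWithin i x (Icc a b) a * gammaPow a i t +
          rlIntegral a α (caputoDeriv a b α x) t := by
  have hu := uniqueDiffOn_Icc hab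
  have ha : a ∈ Icc a b := left_mem_Icc.2 hab.le
  rcases hα.eq_or_lt with rfl | hα
  · have hc : caputoDeriv a b 0 x = x := by ext; simp [caputoDeriv]
    rw [hc]
    exact ⟨by simpa [ContCaputoDiff] using h, by simp [rlIntegral_zero]⟩
  obtain ⟨n, hn⟩ : ∃ n, ⌈α⌉₊ = n + 1 :=
    Nat.exists_eq_succ_of_ne_zero (Nat.ceil_pos.2 hα).ne'
  have hnα : (n : ℝ) < α := Nat.lt_ceil.1 (by omega)
  have hαn : α ≤ n + 1 := by simpa [hn] using Nat.le_ceil α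
  have hδ : 0 ≤ (n + 1 : ℝ) - α := by linarith
  rw [ContCaputoDiff, if_neg hα.ne', ContRLDiff] at h
  obtain ⟨hx, hyc, hw⟩ := h
  replace hw := hw hα.ne'
  set y := subTaylor a b α x with hy
  have hD : caputoDeriv a b α x =
      iteratedDerivWithin (n + 1) (rlIntegral a (n + 1 - α) y) (Icc a b) := by
    ext t
    rw [caputoDeriv, if_neg hα.ne', rlDeriv, if_neg hα.ne', hn]
    push_cast
    rfl
  rw [hn] at hx hw
  push_cast at hw
  rw [add_tsub_cancel_right] at hx
  -- the Taylor polynomial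
  obtain ⟨hT, hT0⟩ := contDiffOn_of_repr hab n (lt_add_one (n : ℝ))
    (fun i => iteratedDerivWithin i x (Icc a b) a) (g := fun _ => 0)
    (x := taylorWithinEval x n (Icc a b) a) continuousOn_const fun t _ => by
      rw [taylorWithinEval_eq_sum_gammaPow]
      simpa using rlIntegral_const_mul a (n + 1) 0 (fun _ => 0) t
  have hyx : y = x - taylorWithinEval x n (Icc a b) a := by
    ext t
    rw [hy, subTaylor, hn, add_tsub_cancel_right, Pi.sub_apply]
  have hyn : ContDiffOn ℝ n y (Icc a b) := hyx ▸ hx.sub hT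
  have hy0 : ∀ i ≤ n, iteratedDerivWithin i y (Icc a b) a = 0 := fun i hi => by
    have hi' : (i : WithTop ℕ∞) ≤ n := by exact_mod_cast hi
    rw [hyx, iteratedDerivWithin_sub ha hu ((hx a ha).of_le hi') ((hT a ha).of_le hi'), hT0 i hi,
      sub_self]
  -- Writing y = J^n v with v = D^n y gives J^{n+1-α} y = J^n J^{n+1-α} v. This shows that the
  -- derivatives of J^{n+1-α} y of orders 0, …, n vanish at a.
  have hv := eqOn_rlIntegral_iteratedDerivWithin hab n hyn fun i hi => hy0 i hi.le
  have hvc : ContinuousOn (iteratedDerivWithin n y (Icc a b)) (Icc a b) :=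
    hyn.continuousOn_iteratedDerivWithin le_rfl hu
  set v := iteratedDerivWithin n y (Icc a b)
  have hva : v a = 0 := hy0 n le_rfl
  have huc : ContinuousOn (rlIntegral a (n + 1 - α) v) (Icc a b) := continuousOn_rlIntegral hδ hvc
  -- For α = n + 1 the integral is the identity, and v(a) = 0 is what is needed.
  have hua : rlIntegral a (n + 1 - α) v a = 0 := by
    rcases hδ.eq_or_lt with h | h
    · rw [← h, rlIntegral_zero, hva]
    · exact rlIntegral_self h v
  have hwu : EqOn (rlIntegral a (n + 1 - α) y) (rlIntegral a n (rlIntegral a (n + 1 - α) v))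
      (Icc a b) := fun t ht => by
    rw [rlIntegral_congr _ hv ht, rlIntegral_rlIntegral hδ n.cast_nonneg hvc ht,
      rlIntegral_rlIntegral n.cast_nonneg hδ hvc ht, add_comm]
  have hwn : EqOn (iteratedDerivWithin n (rlIntegral a (n + 1 - α) y) (Icc a b))
      (rlIntegral a (n + 1 - α) v) (Icc a b) :=
    (iteratedDerivWithin_congr hwu).trans (contDiffOn_rlIntegral_nat hab n huc).2
  have hwz : ∀ i < n + 1, iteratedDerivWithin i (rlIntegral a (n + 1 - α) y) (Icc a b) a = 0 := by
    intro i hi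
    rcases (Nat.lt_succ_iff.1 hi).eq_or_lt with rfl | hi
    · rw [hwn ha, hua]
    -- Here i < n forces n ≥ 1, so the subtraction is not truncated.
    · have hn1 : ((n - 1 : ℕ) : ℝ) < n := by exact_mod_cast (by omega : n - 1 < n)
      rw [iteratedDerivWithin_congr hwu ha]
      exact (contDiffOn_of_repr hab (n - 1) hn1 (fun _ => 0) huc (by simp)).2 i (by omega)
  have hwg := eqOn_rlIntegral_iteratedDerivWithin hab (n + 1) (by exact_mod_cast hw) hwz
  rw [← hD] at hwg
  have hgc : ContinuousOn (caputoDeriv a b α x) (Icc a b) := by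
    rw [hD]
    exact ContDiffOn.continuousOn_iteratedDerivWithin hw (by push_cast; rfl) hu
  set g := caputoDeriv a b α x
  -- Apply J^α to J^{n+1-α} y = J^{n+1} g and commute the integrals; the outer J^{n+1} is then
  -- cancelled by differentiating n + 1 times.
  have hJ : EqOn (rlIntegral a (n + 1 : ℕ) y) (rlIntegral a (n + 1 : ℕ) (rlIntegral a α g))
      (Icc a b) := fun t ht => by
    have h1 := rlIntegral_rlIntegral hα.le hδ hyc ht
    rw [rlIntegral_congr α hwg ht, rlIntegral_rlIntegral hα.le (Nat.cast_nonneg _) hgc ht,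
      sub_add_cancel] at h1
    rw [rlIntegral_rlIntegral (Nat.cast_nonneg _) hα.le hgc ht, add_comm α, h1]
    push_cast
    rfl
  have hyg : EqOn y (rlIntegral a α g) (Icc a b) := fun t ht => by
    rw [← (contDiffOn_rlIntegral_nat hab (n + 1) hyc).2 ht, iteratedDerivWithin_congr hJ ht,
      (contDiffOn_rlIntegral_nat hab (n + 1) (continuousOn_rlIntegral hα.le hgc)).2 ht]
  refine ⟨hgc, fun t ht => ?_⟩
  rw [← hyg ht, hyx, Pi.sub_apply, taylorWithinEval_eq_sum_gammaPow, hn]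
  ring

/-! ### Volterra equations with weakly singular kernels -/

/-- The nonlinear Volterra operator `h ↦ e^{-λ(t-a)} f(t, p_i(t) + J_a^{β_i} (e^{λ(·-a)} h)(t))`. -/
theorem exists_weighted_contraction {a b : ℝ} (hab : a < b) {k : ℕ} {f : ℝ → (Fin k → ℝ) → ℝ}
    (hf : ContinuousOn (Function.uncurry f) (Icc a b ×ˢ univ)) {L : ℝ} (hL : 0 < L)
    (hLip : ∀ t ∈ Icc a b, ∀ y z : Fin k → ℝ, |f t y - f t z| ≤ L * ‖y - z‖)
    {p : Fin k → ℝ → ℝ} (hp : ∀ i, ContinuousOn (p i) (Icc a b)) {β : Fin k → ℝ}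
    (hβ : ∀ i, 0 < β i) :
    ∃ (lam : ℝ) (Φ : C(Icc a b, ℝ) → C(Icc a b, ℝ)), ContractingWith (1 / 2) Φ ∧
      ∀ h t, Φ h t = Real.exp (-(lam * (t - a))) * f t (fun i => p i t +
        rlIntegral a (β i) (fun s => Real.exp (lam * (s - a)) * IccExtend hab.le h s) t) := by
  -- One large λ serves all of the finitely many orders β_i. With the bound 1 / (2 * L), the
  -- Lipschitz constant L of f becomes the contraction factor 1 / 2.
  obtain ⟨lam, hlam, hlamβ⟩ : ∃ lam : ℝ, 0 < lam ∧ ∀ i, (1 / lam) ^ β i ≤ 1 / (2 * L) := by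
    have h1 : ∀ᶠ lam : ℝ in Filter.atTop, ∀ i, lam ^ (-β i) ≤ 1 / (2 * L) :=
      Filter.eventually_all.2 fun i =>
        (tendsto_rpow_neg_atTop (hβ i)).eventually_le_const (by positivity)
    obtain ⟨lam, h2, h3⟩ := (h1.and (Filter.eventually_gt_atTop 0)).exists
    refine ⟨lam, h3, fun i => ?_⟩
    have h4 := h2 i
    rwa [Real.rpow_neg h3.le, ← Real.inv_rpow h3.le, ← one_div] at h4
  have hw : ∀ h : C(Icc a b, ℝ),
      Continuous fun s => Real.exp (lam * (s - a)) * IccExtend hab.le h s := fun h =>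
    (by fun_prop : Continuous fun s : ℝ => Real.exp (lam * (s - a))).mul h.continuous.Icc_extend'
  have hcont : ∀ h : C(Icc a b, ℝ), ContinuousOn (fun t => Real.exp (-(lam * (t - a))) *
      f t (fun i => p i t + rlIntegral a (β i)
        (fun s => Real.exp (lam * (s - a)) * IccExtend hab.le h s) t)) (Icc a b) := fun h => by
    refine ContinuousOn.mul (by fun_prop) ?_
    refine hf.comp (f := fun t => (t, fun i => p i t + rlIntegral a (β i)
        (fun s => Real.exp (lam * (s - a)) * IccExtend hab.le h s) t)) ?_ fun t ht => ⟨ht, trivial⟩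
    exact continuousOn_id.prodMk (continuousOn_pi.2 fun i =>
      (hp i).add (continuousOn_rlIntegral (hβ i).le (hw h).continuousOn))
  refine ⟨lam, fun h => ⟨_, (hcont h).domRestrict⟩, ⟨by norm_num, ?_⟩, fun h t => rfl⟩
  refine LipschitzWith.of_dist_le_mul fun h h' => ?_
  rw [ContinuousMap.dist_le (by positivity)]
  rintro ⟨t, ht⟩
  set D := dist h h'
  have hD : 0 ≤ D := dist_nonneg
  set E := Real.exp (lam * (t - a)) with hE
  have hE0 : 0 < E := Real.exp_pos _
  have hEinv : Real.exp (-(lam * (t - a))) = E⁻¹ := by rw [Real.exp_neg]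
  have hi : ∀ i, |rlIntegral a (β i) (fun s => Real.exp (lam * (s - a)) * IccExtend hab.le h s) t -
      rlIntegral a (β i) (fun s => Real.exp (lam * (s - a)) * IccExtend hab.le h' s) t| ≤
        D * (1 / (2 * L) * E) := fun i => by
    rw [← rlIntegral_sub (hβ i).le ht (hw h).continuousOn (hw h').continuousOn]
    refine (abs_rlIntegral_le (hβ i).le ht ((hw h).fun_sub (hw h')).continuousOn
      (g := fun s => D * Real.exp (lam * (s - a))) (by fun_prop) fun s hs => ?_).trans ?_
    · rw [← mul_sub, abs_mul, abs_of_pos (Real.exp_pos _), mul_comm, IccExtend_of_mem _ _ hs,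
        IccExtend_of_mem _ _ hs, ← Real.dist_eq]
      exact mul_le_mul_of_nonneg_right (ContinuousMap.dist_apply_le_dist _) (Real.exp_pos _).le
    · rw [rlIntegral_const_mul]
      refine mul_le_mul_of_nonneg_left ((rlIntegral_exp_le (hβ i) hlam ht.1).trans ?_) hD
      exact mul_le_mul_of_nonneg_right (hlamβ i) hE0.le
  rw [Real.dist_eq]
  simp only [ContinuousMap.coe_mk, Set.domRestrict_apply]
  rw [← mul_sub, abs_mul, abs_of_pos (Real.exp_pos _), hEinv]
  have hn := hLip t ht
    (fun i => p i t + rlIntegral a (β i)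
      (fun s => Real.exp (lam * (s - a)) * IccExtend hab.le h s) t)
    (fun i => p i t + rlIntegral a (β i)
      (fun s => Real.exp (lam * (s - a)) * IccExtend hab.le h' s) t)
  have hn' : ‖(fun i => p i t + rlIntegral a (β i)
      (fun s => Real.exp (lam * (s - a)) * IccExtend hab.le h s) t) -
    (fun i => p i t + rlIntegral a (β i)
      (fun s => Real.exp (lam * (s - a)) * IccExtend hab.le h' s) t)‖ ≤
      D * (1 / (2 * L) * E) := by
    rw [pi_norm_le_iff_of_nonneg (by positivity)]
    intro i
    rw [Pi.sub_apply, add_sub_add_left_eq_sub]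
    exact hi i
  calc E⁻¹ * _ ≤ E⁻¹ * (L * (D * (1 / (2 * L) * E))) := by
        refine mul_le_mul_of_nonneg_left (hn.trans ?_) (inv_pos.2 hE0).le
        exact mul_le_mul_of_nonneg_left hn' hL.le
    _ = ((1 / 2 : NNReal) : ℝ) * D := by
        push_cast
        field_simp

/-- Unique solvability of a nonlinear Volterra equation with weakly singular kernels. -/
theorem existsUnique_volterra {a b : ℝ} (hab : a < b) {k : ℕ} {f : ℝ → (Fin k → ℝ) → ℝ}
    (hf : ContinuousOn (Function.uncurry f) (Icc a b ×ˢ univ)) {L : ℝ} (hL : 0 < L)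
    (hLip : ∀ t ∈ Icc a b, ∀ y z : Fin k → ℝ, |f t y - f t z| ≤ L * ‖y - z‖)
    {p : Fin k → ℝ → ℝ} (hp : ∀ i, ContinuousOn (p i) (Icc a b)) {β : Fin k → ℝ}
    (hβ : ∀ i, 0 < β i) :
    ∃ g, (ContinuousOn g (Icc a b) ∧
        ∀ t ∈ Icc a b, g t = f t (fun i => p i t + rlIntegral a (β i) g t)) ∧
      ∀ g', ContinuousOn g' (Icc a b) →
        (∀ t ∈ Icc a b, g' t = f t (fun i => p i t + rlIntegral a (β i) g' t)) →
        EqOn g' g (Icc a b) := by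
  obtain ⟨lam, Φ, hΦ, hΦf⟩ := exists_weighted_contraction hab hf hL hLip hp hβ
  have : Nonempty (Icc a b) := ⟨⟨a, left_mem_Icc.2 hab.le⟩⟩
  have hexp : ∀ t : ℝ, Real.exp (-(lam * (t - a))) = (Real.exp (lam * (t - a)))⁻¹ :=
    fun t => Real.exp_neg _
  set h := ContractingWith.fixedPoint Φ hΦ
  have hh : Φ h = h := hΦ.fixedPoint_isFixedPt
  refine ⟨fun s => Real.exp (lam * (s - a)) * IccExtend hab.le h s, ⟨?_, fun t ht => ?_⟩,
    fun g' hg' hg'f t ht => ?_⟩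
  · exact ((by fun_prop : Continuous fun s : ℝ => Real.exp (lam * (s - a))).mul
      h.continuous.Icc_extend').continuousOn
  · have h1 := hΦf h ⟨t, ht⟩
    rw [hh] at h1
    beta_reduce
    rw [IccExtend_of_mem _ _ ht, h1, hexp, mul_inv_cancel_left₀ (Real.exp_pos _).ne']
  · have hcont : ContinuousOn (fun t => Real.exp (-(lam * (t - a))) * g' t) (Icc a b) :=
      ContinuousOn.mul (by fun_prop) hg'
    set h' : C(Icc a b, ℝ) := ⟨_, hcont.domRestrict⟩ with h'_def
    have happ : ∀ s (hs : s ∈ Icc a b), h' ⟨s, hs⟩ = Real.exp (-(lam * (s - a))) * g' s :=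
      fun s hs => rfl
    have hext : EqOn (fun s => Real.exp (lam * (s - a)) * IccExtend hab.le h' s) g' (Icc a b) :=
      fun s hs => by
        beta_reduce
        rw [IccExtend_of_mem _ _ hs, happ, hexp, mul_inv_cancel_left₀ (Real.exp_pos _).ne']
    -- Any solution, once multiplied by the weight e^{-λ(t-a)}, is a fixed point, so uniqueness is
    -- that of Banach's theorem.
    have hfix : Φ h' = h' := by
      ext ⟨s, hs⟩
      rw [hΦf, happ]
      simp only [rlIntegral_congr _ hext hs]
      rw [← hg'f s hs]
    rw [← hext ht]
    beta_reduce
    rw [hΦ.fixedPoint_unique (x := h') hfix]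

/-! ### Chains of fractional integrals of order γ -/

/-- A chain `u_j = c_j + J_a^γ u_{j+1}`, `j < N`, of continuous functions on `[a,b]`. -/
structure IsChain (a b γ : ℝ) (c : ℕ → ℝ) (N : ℕ) (u : ℕ → ℝ → ℝ) : Prop where
  continuousOn : ∀ j ≤ N, ContinuousOn (u j) (Icc a b)
  step : ∀ j < N, ∀ t ∈ Icc a b, u j t = c j + rlIntegral a γ (u (j + 1)) t

/-- The chain relation is substituted into itself n times: the constant met at the l-th substitution
has been integrated l times and becomes a power of exponent lγ. -/
theorem IsChain.repr {a b γ : ℝ} (hγ : 0 ≤ γ) {c : ℕ → ℝ} {N : ℕ} {u : ℕ → ℝ → ℝ}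
    (h : IsChain a b γ c N u) (n i : ℕ) (hi : i + n ≤ N) : ∀ t ∈ Icc a b,
      u i t = ∑ l ∈ Finset.range n, c (i + l) * gammaPow a (l * γ) t +
        rlIntegral a (n * γ) (u (i + n)) t := by
  induction n generalizing i with
  | zero => simp [rlIntegral_zero]
  | succ n ih =>
    intro t ht
    have hn : 0 ≤ (n : ℝ) * γ := by positivity
    have hu := h.continuousOn (i + 1 + n) (by omega)
    have hν : ∀ l : ℕ, 0 ≤ (l : ℝ) * γ := fun l => by positivity
    rw [h.step i (by omega) t ht, rlIntegral_congr γ (ih (i + 1) (by omega)) ht,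
      rlIntegral_add hγ ht (continuous_sum_gammaPow a n _ hν).continuousOn
        (continuousOn_rlIntegral hn hu), rlIntegral_sum_gammaPow hγ n _ hν ht,
      rlIntegral_rlIntegral hγ hn hu ht, Finset.sum_range_succ', add_assoc i 1 n, add_comm 1 n]
    have h1 : ∀ l : ℕ, c (i + 1 + l) * gammaPow a (l * γ + γ) t =
        c (i + (l + 1)) * gammaPow a ((l + 1 : ℕ) * γ) t := fun l => by
      push_cast
      rw [add_mul, one_mul, add_assoc, add_comm 1 l]
    simp only [h1, Nat.cast_zero, zero_mul, gammaPow_zero, Nat.cast_add, Nat.cast_one, add_mul,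
      one_mul]
    simp only [add_zero, mul_one]
    ring

/-- The chain with last member `g`. -/
def chainOf (a γ : ℝ) (c : ℕ → ℝ) (N : ℕ) (g : ℝ → ℝ) (j : ℕ) (t : ℝ) : ℝ :=
  ∑ l ∈ Finset.range (N - j), c (j + l) * gammaPow a (l * γ) t +
    rlIntegral a ((N - j : ℕ) * γ) g t

theorem chainOf_self (a γ : ℝ) (c : ℕ → ℝ) (N : ℕ) (g : ℝ → ℝ) : chainOf a γ c N g N = g := by
  ext t; simp [chainOf, rlIntegral_zero]

theorem isChain_chainOf {a b γ : ℝ} (hγ : 0 ≤ γ) (c : ℕ → ℝ) (N : ℕ) {g : ℝ → ℝ}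
    (hg : ContinuousOn g (Icc a b)) : IsChain a b γ c N (chainOf a γ c N g) := by
  have hν : ∀ l : ℕ, 0 ≤ (l : ℝ) * γ := fun l => by positivity
  refine ⟨fun j _ => ?_, fun j hj t ht => ?_⟩
  · exact (continuous_sum_gammaPow a _ _ hν).continuousOn.add (continuousOn_rlIntegral (hν _) hg)
  · obtain ⟨n, rfl⟩ : ∃ n, N = j + 1 + n := Nat.exists_eq_add_of_le hj
    unfold chainOf
    rw [rlIntegral_add hγ ht (continuous_sum_gammaPow a _ _ hν).continuousOn
      (continuousOn_rlIntegral (hν _) hg), rlIntegral_sum_gammaPow hγ _ _ hν ht,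
      rlIntegral_rlIntegral hγ (hν _) hg ht, Nat.add_sub_cancel_left,
      show j + 1 + n - j = n + 1 by omega, Finset.sum_range_succ']
    have h1 : ∀ l : ℕ, c (j + 1 + l) * gammaPow a (l * γ + γ) t =
        c (j + (l + 1)) * gammaPow a ((l + 1 : ℕ) * γ) t := fun l => by
      push_cast
      rw [add_mul, one_mul, add_assoc, add_comm 1 l]
    simp only [h1, Nat.cast_zero, zero_mul, gammaPow_zero, Nat.cast_add, Nat.cast_one, add_mul,
      one_mul]
    simp only [add_zero, mul_one]
    ring

/-- A chain is determined by its last member, which transfers uniqueness from u_N to the whole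
chain. -/
theorem IsChain.eqOn_chainOf {a b γ : ℝ} (hγ : 0 ≤ γ) {c : ℕ → ℝ} {N : ℕ} {u : ℕ → ℝ → ℝ}
    (h : IsChain a b γ c N u) {j : ℕ} (hj : j ≤ N) :
    EqOn (u j) (chainOf a γ c N (u N) j) (Icc a b) := fun t ht => by
  have h1 := h.repr hγ (N - j) j (by omega) t ht
  rwa [Nat.add_sub_of_le hj] at h1

/-- The initial values of the reduced system. -/
def initVal (M : ℕ) (ξ : ℕ → ℝ) (j : ℕ) : ℝ := if M ∣ j then ξ (j / M) else 0

/-- Only indices l = Mq carry a nonzero value, and their exponents are the integers q; moreover Mq <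
j exactly when q < ⌈j/M⌉. The fractional powers drop out and a Taylor polynomial of the right length
remains. -/
theorem sum_initVal {M : ℕ} (hM : 0 < M) (ξ : ℕ → ℝ) (a : ℝ) (j : ℕ) (t : ℝ) :
    ∑ l ∈ Finset.range j, initVal M ξ l * gammaPow a (l * (1 / M)) t =
      ∑ q ∈ Finset.range ⌈(j : ℝ) / M⌉₊, ξ q * gammaPow a q t := by
  have hM' : (0 : ℝ) < M := by exact_mod_cast hM
  have hlt : ∀ q : ℕ, q < ⌈(j : ℝ) / M⌉₊ ↔ M * q < j := fun q => by
    rw [Nat.lt_ceil, lt_div_iff₀ hM', mul_comm]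
    exact_mod_cast Iff.rfl
  symm
  refine Finset.sum_of_injOn (fun q => M * q) (fun p _ q _ h => Nat.eq_of_mul_eq_mul_left hM h)
    (fun q hq => ?_) (fun l hl hl' => ?_) fun q hq => ?_
  · simpa [hlt] using hq
  · rw [initVal, if_neg, zero_mul]
    rintro ⟨q, rfl⟩
    exact hl' ⟨q, by simpa [hlt] using hl, rfl⟩
  · rw [initVal, if_pos (dvd_mul_right M q), Nat.mul_div_cancel_left q hM]
    congr 2
    push_cast
    field_simp

/-- The Caputo derivatives of order `j / M` of the zeroth member of a chain of order `1 / M`. -/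
theorem IsChain.contCaputoDiff_zero {a b : ℝ} (hab : a < b) {M : ℕ} (hM : 0 < M) {ξ : ℕ → ℝ}
    {N : ℕ} {u : ℕ → ℝ → ℝ} (h : IsChain a b (1 / M) (initVal M ξ) N u) {x : ℝ → ℝ}
    (hx : EqOn x (u 0) (Icc a b)) {j : ℕ} (hj : j ≤ N) :
    ContCaputoDiff a b ((j : ℝ) / M) x ∧ EqOn (caputoDeriv a b ((j : ℝ) / M) x) (u j) (Icc a b) ∧
      ∀ q < ⌈(j : ℝ) / M⌉₊, iteratedDerivWithin q x (Icc a b) a = ξ q := by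
  refine contCaputoDiff_of_repr hab (by positivity) ξ (h.continuousOn j hj) fun t ht => ?_
  have h1 := h.repr (by positivity) j 0 (by omega) t ht
  simp only [zero_add] at h1
  rw [hx ht, h1, sum_initVal hM, mul_one_div]

theorem ceil_one_div {M : ℕ} (hM : 0 < M) : ⌈(1 : ℝ) / M⌉₊ = 1 := by
  have hM' : (1 : ℝ) ≤ M := by exact_mod_cast hM
  rw [Nat.ceil_eq_iff one_ne_zero]
  simp only [tsub_self, Nat.cast_zero, Nat.cast_one]
  exact ⟨by positivity, (div_le_one (by positivity)).2 hM'⟩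

/-- Consecutive members of a chain of order `1 / M`. -/
theorem IsChain.contCaputoDiff_step {a b : ℝ} (hab : a < b) {M : ℕ} (hM : 0 < M) {c : ℕ → ℝ}
    {N : ℕ} {u : ℕ → ℝ → ℝ} (h : IsChain a b (1 / M) c N u) {j : ℕ} (hj : j < N) {x : ℝ → ℝ}
    (hx : EqOn x (u j) (Icc a b)) :
    ContCaputoDiff a b (1 / M) x ∧ EqOn (caputoDeriv a b (1 / M) x) (u (j + 1)) (Icc a b) ∧
      x a = c j := by
  have h1 := contCaputoDiff_of_repr hab (α := 1 / M) (by positivity) (fun _ => c j)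
    (h.continuousOn (j + 1) hj) (x := x) fun t ht => by
      rw [ceil_one_div hM, Finset.sum_range_one, Nat.cast_zero, gammaPow_zero, mul_one, hx ht,
        h.step j hj t ht]
  refine ⟨h1.1, h1.2.1, ?_⟩
  simpa using h1.2.2 0 (by rw [ceil_one_div hM]; exact one_pos)

theorem ContCaputoDiff.repr_one_div {a b : ℝ} (hab : a < b) {M : ℕ} (hM : 0 < M) {x : ℝ → ℝ}
    (h : ContCaputoDiff a b (1 / M) x) : ContinuousOn (caputoDeriv a b (1 / M) x) (Icc a b) ∧
      ∀ t ∈ Icc a b, x t = x a + rlIntegral a (1 / M) (caputoDeriv a b (1 / M) x) t := by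
  obtain ⟨h1, h2⟩ := h.repr hab (by positivity)
  refine ⟨h1, fun t ht => ?_⟩
  rw [h2 t ht, ceil_one_div hM, Finset.sum_range_one, Nat.cast_zero, gammaPow_zero, mul_one,
    iteratedDerivWithin_zero]

/-! ### Multi-term problem and reduced system as closed chains -/

section Orders

variable {k : ℕ} {α : Fin (k + 1) → ℚ}

theorem cast_eq_scaled_div (h0 : α 0 = 0) (hα : StrictMono α) (i : Fin (k + 1)) :
    ((α i : ℚ) : ℝ) = (scaled α i : ℝ) / lcmDen α := by
  have hM : (0 : ℝ) < lcmDen α := by exact_mod_cast lcmDen_pos α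
  have h := scaled_cast α i (h0 ▸ hα.monotone (Fin.zero_le i))
  have h' : ((scaled α i : ℚ) : ℝ) = ((lcmDen α * α i : ℚ) : ℝ) := by rw [h]
  push_cast at h'
  rw [h']
  field_simp

/-- Reconciles the rational ceiling in the initial conditions with the real one in the Caputo
derivative. -/
theorem natCeil_ratCast_real (q : ℚ) : ⌈(q : ℝ)⌉₊ = ⌈q⌉₊ :=
  eq_of_forall_lt_iff fun n => by
    rw [Nat.lt_ceil, Nat.lt_ceil]
    exact_mod_cast Iff.rfl

variable {a b : ℝ} {f : ℝ → (Fin k → ℝ) → ℝ} {ξ : ℕ → ℝ}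

/-- A chain of order `1 / M` closed by the right-hand side `f`. -/
structure IsClosedChain (a b : ℝ) (α : Fin (k + 1) → ℚ) (f : ℝ → (Fin k → ℝ) → ℝ) (ξ : ℕ → ℝ)
    (u : ℕ → ℝ → ℝ) : Prop where
  chain : IsChain a b (1 / lcmDen α) (initVal (lcmDen α) ξ) (dim α) u
  closing : ∀ t ∈ Icc a b, u (dim α) t = f t (fun i => u (scaled α i.castSucc) t)

theorem IsClosedChain.isMultiTermSolution (hab : a < b) (h0 : α 0 = 0) (hα : StrictMono α)
    {u : ℕ → ℝ → ℝ} (h : IsClosedChain a b α f ξ u) :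
    IsMultiTermSolution a b α f ξ (u 0) := by
  have hM := lcmDen_pos α
  have hlast := h.chain.contCaputoDiff_zero hab hM (fun _ _ => rfl) le_rfl
  rw [dim, ← cast_eq_scaled_div h0 hα] at hlast
  refine ⟨hlast.1, fun t ht => ?_, fun j hj => hlast.2.2 j (by rwa [natCeil_ratCast_real])⟩
  rw [hlast.2.1 ht]
  refine (h.closing t ht).trans (congrArg (f t) (funext fun i => ?_))
  rw [cast_eq_scaled_div h0 hα]
  exact ((h.chain.contCaputoDiff_zero hab hM (fun _ _ => rfl)
    (scaled_lt α h0 hα i).le).2.1 ht).symm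

theorem IsClosedChain.isReducedSolution (hab : a < b) (h0 : α 0 = 0) (hα : StrictMono α)
    {u : ℕ → ℝ → ℝ} (h : IsClosedChain a b α f ξ u) {X : Fin (dim α) → ℝ → ℝ}
    (hX : ∀ j : Fin (dim α), EqOn (X j) (u j) (Icc a b)) :
    IsReducedSolution a b α h0 hα f ξ X := by
  have key := fun j : Fin (dim α) => h.chain.contCaputoDiff_step hab (lcmDen_pos α) j.2 (hX j)
  refine ⟨fun j => (key j).1, fun i j hij t ht => ?_, fun j hj t ht => ?_, fun j => (key j).2.2⟩
  · rw [(key i).2.1 ht, hij, hX j ht]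
  · rw [(key j).2.1 ht, hj, h.closing t ht]
    exact congrArg (f t) (funext fun i => (hX (termIndex α h0 hα i) ht).symm)

/-- The integral form of each equation of order γ is one chain step; the right-hand side of the last
equation is appended as the member u_N. -/
theorem IsReducedSolution.exists_isClosedChain (hab : a < b) {h0 : α 0 = 0} {hα : StrictMono α}
    (hf : ContinuousOn (Function.uncurry f) (Icc a b ×ˢ univ)) {X : Fin (dim α) → ℝ → ℝ}
    (h : IsReducedSolution a b α h0 hα f ξ X) :
    ∃ u, IsClosedChain a b α f ξ u ∧ ∀ j : Fin (dim α), X j = u j := by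
  have hM := lcmDen_pos α
  have hXc : ∀ j, ContinuousOn (X j) (Icc a b) := fun j => by
    obtain ⟨h1, h2⟩ := (h.contDiff j).repr_one_div hab hM
    exact (continuousOn_const.add (continuousOn_rlIntegral (by positivity) h1)).congr h2
  set F : ℝ → ℝ := fun t => f t (fun i => X (termIndex α h0 hα i) t)
  have hFc : ContinuousOn F (Icc a b) :=
    hf.comp (f := fun t => (t, fun i => X (termIndex α h0 hα i) t))
      (continuousOn_id.prodMk (continuousOn_pi.2 fun i => hXc _)) fun t ht => ⟨ht, trivial⟩
  obtain ⟨u, hu, huN⟩ : ∃ u : ℕ → ℝ → ℝ, (∀ j : Fin (dim α), X j = u j) ∧ u (dim α) = F :=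
    -- Of the indices that receive the default F, only `dim α` matters.
    ⟨fun j => if hj : j < dim α then X ⟨j, hj⟩ else F, fun j => by simp, by simp⟩
  refine ⟨u, ⟨⟨fun j hj => ?_, fun j hj t ht => ?_⟩, fun t ht => ?_⟩, hu⟩
  · rcases hj.eq_or_lt with rfl | hj
    · rwa [huN]
    · exact hu ⟨j, hj⟩ ▸ hXc ⟨j, hj⟩
  · rw [← hu ⟨j, hj⟩, ((h.contDiff ⟨j, hj⟩).repr_one_div hab hM).2 t ht, h.initial ⟨j, hj⟩]
    refine congrArg (initVal (lcmDen α) ξ j + ·) (rlIntegral_congr _ (fun s hs => ?_) ht)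
    rcases (Nat.succ_le_of_lt hj).eq_or_lt with hj' | hj'
    · rw [h.equation ⟨j, hj⟩ hj' s hs, ← Nat.succ_eq_add_one, hj', huN]
    · rw [h.chain ⟨j, hj⟩ ⟨j + 1, hj'⟩ rfl s hs, hu ⟨j + 1, hj'⟩]
  · rw [huN]
    exact congrArg (f t) (funext fun i => congrFun (hu (termIndex α h0 hα i)) t)

/-- The chain is built downwards from g = D^{α_k} x. By the Taylor representation x is its zeroth
member, so the lower Caputo derivatives of x are the other members and the equation for x closes the
chain. -/
theorem IsMultiTermSolution.exists_isClosedChain (hab : a < b) (h0 : α 0 = 0) (hα : StrictMono α)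
    {x : ℝ → ℝ} (h : IsMultiTermSolution a b α f ξ x) :
    ∃ u, IsClosedChain a b α f ξ u ∧ EqOn x (u 0) (Icc a b) := by
  have hM := lcmDen_pos α
  have hlast : ((α (Fin.last k) : ℚ) : ℝ) = (dim α : ℝ) / lcmDen α := cast_eq_scaled_div h0 hα _
  obtain ⟨hgc, hg⟩ := h.contDiff.repr hab (by rw [hlast]; positivity)
  set g := caputoDeriv a b (α (Fin.last k)) x with hg_def
  have hchain := isChain_chainOf (γ := 1 / lcmDen α) (by positivity) (initVal (lcmDen α) ξ)
    (dim α) hgc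
  have hx : EqOn x (chainOf a (1 / lcmDen α) (initVal (lcmDen α) ξ) (dim α) g 0) (Icc a b) :=
    fun t ht => by
      rw [hg t ht, chainOf]
      simp only [zero_add, tsub_zero]
      rw [sum_initVal hM, mul_one_div, ← hlast, add_left_inj]
      refine Finset.sum_congr rfl fun i hi => ?_
      rw [Finset.mem_range, natCeil_ratCast_real] at hi
      rw [h.initial i hi]
  refine ⟨_, ⟨hchain, fun t ht => ?_⟩, hx⟩
  rw [chainOf_self, hg_def, h.equation t ht]
  refine congrArg (f t) (funext fun i => ?_)
  rw [cast_eq_scaled_div h0 hα]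
  exact (hchain.contCaputoDiff_zero hab hM hx (scaled_lt α h0 hα i).le).2.1 ht

theorem existsUnique_isClosedChain (hab : a < b) (h0 : α 0 = 0) (hα : StrictMono α)
    (hf : ContinuousOn (Function.uncurry f) (Icc a b ×ˢ univ)) {L : ℝ} (hL : 0 < L)
    (hLip : ∀ t ∈ Icc a b, ∀ y z : Fin k → ℝ, |f t y - f t z| ≤ L * ‖y - z‖) :
    ∃ u, IsClosedChain a b α f ξ u ∧ ∀ v, IsClosedChain a b α f ξ v →
      ∀ j ≤ dim α, EqOn (v j) (u j) (Icc a b) := by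
  have hM : (0 : ℝ) < lcmDen α := by exact_mod_cast lcmDen_pos α
  have hγ : (0 : ℝ) ≤ 1 / lcmDen α := by positivity
  obtain ⟨g, ⟨hgc, hg⟩, huniq⟩ := existsUnique_volterra hab hf hL hLip
    -- The data p_i and β_i come from `chainOf` at the index Mα_i; the order β_i is positive because
    -- Mα_i < N.
    (p := fun i t => ∑ l ∈ Finset.range (dim α - scaled α i.castSucc),
      initVal (lcmDen α) ξ (scaled α i.castSucc + l) * gammaPow a (l * (1 / lcmDen α)) t)
    (β := fun i => (dim α - scaled α i.castSucc : ℕ) * (1 / lcmDen α))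
    (fun i => (continuous_sum_gammaPow a _ _ fun l => by positivity).continuousOn)
    (fun i => mul_pos (by exact_mod_cast Nat.sub_pos_of_lt (scaled_lt α h0 hα i))
      (by positivity))
  have hchain := isChain_chainOf hγ (initVal (lcmDen α) ξ) (dim α) hgc
  refine ⟨_, ⟨hchain, fun t ht => ?_⟩, fun v hv j hj => ?_⟩
  · rw [chainOf_self]
    exact hg t ht
  · have h1 : EqOn (v (dim α)) g (Icc a b) := by
      refine huniq _ (hv.chain.continuousOn _ le_rfl) fun t ht => (hv.closing t ht).trans ?_
      exact congrArg (f t) (funext fun i =>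
        hv.chain.eqOn_chainOf hγ (scaled_lt α h0 hα i).le ht)
    intro t ht
    rw [hv.chain.eqOn_chainOf hγ hj ht, chainOf, chainOf, rlIntegral_congr _ h1 ht]

end Orders

end Caputo

end

theorem corollary4p1 (a b : ℝ) (hab : a < b) (k : ℕ) (hk : 0 < k)
    (α : Fin (k + 1) → ℚ) (h0 : α 0 = 0) (hα : StrictMono α)
    (hgap : ∀ i : Fin k, α i.succ - α i.castSucc ≤ 1)
    (f : ℝ → (Fin k → ℝ) → ℝ)
    (hf : ContinuousOn (Function.uncurry f) (Set.Icc a b ×ˢ Set.univ))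
    (L : ℝ) (hL : 0 < L)
    (hLip : ∀ t ∈ Set.Icc a b, ∀ y z : Fin k → ℝ, |f t y - f t z| ≤ L * ‖y - z‖)
    (ξ : ℕ → ℝ) :
    -- the multi-term problem has a unique solution on `[a,b]`
    (∃ x, Caputo.IsMultiTermSolution a b α f ξ x ∧
      ∀ y, Caputo.IsMultiTermSolution a b α f ξ y → Set.EqOn y x (Set.Icc a b)) ∧
    -- the reduced system has a unique solution on `[a,b]`
    (∃ X, Caputo.IsReducedSolution a b α h0 hα f ξ X ∧
      ∀ Y, Caputo.IsReducedSolution a b α h0 hα f ξ Y → ∀ j, Set.EqOn (Y j) (X j) (Set.Icc a b)) ∧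
    -- the zeroth component of a solution of the system solves the multi-term problem
    (∀ X, Caputo.IsReducedSolution a b α h0 hα f ξ X →
      Caputo.IsMultiTermSolution a b α f ξ (X ⟨0, Caputo.dim_pos α h0 hα hk⟩)) ∧
    -- the derivatives of order `j γ` of a solution of the multi-term problem exist and are
    -- continuous, and they solve the system
    (∀ x, Caputo.IsMultiTermSolution a b α f ξ x →
      (∀ j ≤ Caputo.dim α, Caputo.ContCaputoDiff a b ((j : ℝ) / Caputo.lcmDen α) x) ∧
      Caputo.IsReducedSolution a b α h0 hα f ξ
        (fun j => Caputo.caputoDeriv a b ((j : ℝ) / Caputo.lcmDen α) x)) := by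
  have hM := Caputo.lcmDen_pos α
  obtain ⟨u, hu, huniq⟩ := Caputo.existsUnique_isClosedChain (ξ := ξ) hab h0 hα hf hL hLip
  refine ⟨⟨u 0, hu.isMultiTermSolution hab h0 hα, fun y hy => ?_⟩,
    ⟨fun j => u j, hu.isReducedSolution hab h0 hα fun _ _ _ => rfl, fun Y hY j => ?_⟩,
    fun X hX => ?_, fun x hx => ?_⟩
  · obtain ⟨v, hv, hyv⟩ := hy.exists_isClosedChain hab h0 hα
    exact hyv.trans (huniq v hv 0 (Nat.zero_le _))
  · obtain ⟨v, hv, hYv⟩ := hY.exists_isClosedChain hab hf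
    rw [hYv j]
    exact huniq v hv j j.2.le
  · obtain ⟨v, hv, hXv⟩ := hX.exists_isClosedChain hab hf
    rw [hXv]
    exact hv.isMultiTermSolution hab h0 hα
  · obtain ⟨v, hv, hxv⟩ := hx.exists_isClosedChain hab h0 hα
    have key := fun j hj => hv.chain.contCaputoDiff_zero hab hM hxv (j := j) hj
    exact ⟨fun j hj => (key j hj).1,
      hv.isReducedSolution hab h0 hα fun j => (key j j.2.le).2.1⟩
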